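/- An \emph{mm-space} is a triple $(X,d_X,\mu_X)$, where $(X,d_X)$ is a nonempty complete separable metric space and $\mu_X$ is a finite Borel measure on $X$ (the zero measure is allowed). With $m:=\mu_X(X)$, a \emph{parameter} of $X$ is a Borel map $\varphi:[0,m]\to X$ with $\varphi_*\mathcal L=\mu_X$, where $\mathcal L$ is the Lebesgue measure on $[0,m]$. For functions $d_1,d_2:[0,m]^2\to\mathbb R$, let $\square_1(d_1,d_2)$ be the infimum of all $\varepsilon>0$ for which there is a measurable set $T\subseteq[0,m]$ with $\mathcal L(T)\ge m-\varepsilon$ and $|d_1(s,t)-d_2(s,t)|\le\varepsilon$ for all $s,t\in T$. If $\mu_X(X)=\mu_Y(Y)=m$, put $$\underline{\square}_1(X,Y):=\inf_{\varphi,\psi}\ \square_1(\varphi^*d_X,\psi^*d_Y),$$ where $\varphi:[0,m]\to X$ and $\psi:[0,m]\to Y$ run over all parameters and $\varphi^*d_X(s,t):=d_X(\varphi(s),\varphi(t))$. If $m:=\mu_X(X)<m':=\mu_Y(Y)$, put $$\underline{\square}_1(X,Y)=\underline{\square}_1(Y,X):=\underline{\square}_1\big(X,(Y,d_Y,\tfrac{m}{m'}\mu_Y)\big)+m'-m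 .$$ \textbf{Theorem (Gromov).} Let $X$ and $X_n$, $n\in\mathbb N$, be mm-spaces. Then $\underline{\square}_1(X_n,X)\to0$ as $n\to\infty$ if and only if for every $n\in\mathbb N$ there are a Borel map $p_n:X_n\to X$, a Borel subset $\widetilde X_n\subseteq X_n$ and a number $\varepsilon_n>0$ such that \begin{enumerate} \item[(1)] $\varepsilon_n\to0$ as $n\to\infty$; \item[(2)] $\mu_{X_n}(X_n\setminus\widetilde X_n)\le\varepsilon_n$ for every $n$; \item[(3)] $|d_{X_n}(x,y)-d_X(p_n(x),p_n(y))|\le\varepsilon_n$ for every $n$ and all $x,y\in\widetilde X_n$; \item[(4)] the measures $(p_n)_*\mu_{X_n}$ converge weakly to $\mu_X$ as $n\to\infty$, that is, $\int f\,d(p_n)_*\mu_{X_n}\to\int f\,d\mu_X$ for every bounded continuous $f:X\to\mathbb R$. \end{enumerate} -/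

import Mathlib

open MeasureTheory Filter Topology
open scoped NNReal ENNReal

namespace MMSpaces

/-- The distance `□_lam (d₁, d₂)` of two functions `d₁, d₂ : S × S → ℝ` on a measure space
`(S, μ)` of finite measure: the infimum of all `ε > 0` for which there is a measurable set `T` with
`μ T ≥ μ S - lam * ε` and `|d₁ x y - d₂ x y| ≤ ε` on `T × T`
(the infimum is `∞` if there is no such `ε`, which can only happen for `lam = 0`). -/
noncomputable def boxFun {S : Type*} [MeasurableSpace S] (μ : Measure S) (lam : ℝ≥0)
    (d₁ d₂ : S → S → ℝ) : ℝ≥0∞ :=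
  sInf {e : ℝ≥0∞ | ∃ ε : ℝ≥0, 0 < ε ∧ e = ε ∧
    ∃ T : Set S, MeasurableSet T ∧ μ Set.univ ≤ μ T + lam * ε ∧
      ∀ x ∈ T, ∀ y ∈ T, |d₁ x y - d₂ x y| ≤ ε}

/-- The Lebesgue measure on the interval `[0, m]`. -/
noncomputable def lebesgueIcc (m : ℝ≥0) : Measure (Set.Icc (0 : ℝ) m) :=
  (volume : Measure ℝ).comap Subtype.val

/-- A parameter `φ : [0, m] → X` of `(X, μ)`, where `m = μ X`: a Borel map that pushes the Lebesgue
measure of the interval `[0, m]` forward to `μ`. -/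
def IsParameter {X : Type*} [MeasurableSpace X] (μ : FiniteMeasure X) {m : ℝ≥0}
    (φ : Set.Icc (0 : ℝ) m → X) : Prop :=
  m = μ.mass ∧ Measurable φ ∧ (lebesgueIcc m).map φ = (μ : Measure X)

/-- The box distance of two metric measure spaces `(X, μ)`, `(Y, ν)` of the same total mass `m`:
the infimum of `□_lam (φ^* d_X, ψ^* d_Y)` over all parameters `φ : [0, m] → X`,
`ψ : [0, m] → Y`. -/
noncomputable def boxDistEqMass (lam m : ℝ≥0) {X Y : Type*}
    [MetricSpace X] [MeasurableSpace X] [MetricSpace Y] [MeasurableSpace Y]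
    (μ : FiniteMeasure X) (ν : FiniteMeasure Y) : ℝ≥0∞ :=
  sInf {e : ℝ≥0∞ | ∃ (φ : Set.Icc (0 : ℝ) m → X) (ψ : Set.Icc (0 : ℝ) m → Y),
    IsParameter μ φ ∧ IsParameter ν ψ ∧
      e = boxFun (lebesgueIcc m) lam
        (fun s t => dist (φ s) (φ t)) (fun s t => dist (ψ s) (ψ t))}

/-- Gromov's box distance of two metric measure spaces `(X, μ)`, `(Y, ν)`. If the total masses
differ, the measure of larger mass is scaled down to the smaller mass and the difference of the
masses is added. -/
noncomputable def boxDist (lam : ℝ≥0) {X Y : Type*}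
    [MetricSpace X] [MeasurableSpace X] [MetricSpace Y] [MeasurableSpace Y]
    (μ : FiniteMeasure X) (ν : FiniteMeasure Y) : ℝ≥0∞ :=
  if μ.mass = ν.mass then boxDistEqMass lam μ.mass μ ν
  else if μ.mass < ν.mass then
    boxDistEqMass lam μ.mass μ ((μ.mass / ν.mass) • ν) + ((ν.mass - μ.mass : ℝ≥0) : ℝ≥0∞)
  else
    boxDistEqMass lam ν.mass ((ν.mass / μ.mass) • μ) ν + ((μ.mass - ν.mass : ℝ≥0) : ℝ≥0∞)

end MMSpaces

/-!
The distance `boxDist` compares two spaces through a pair of parameters, which is the same as a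
coupling of the (rescaled) measures: a pair of parameters pushes Lebesgue measure forward to a
coupling, and conversely a coupling `π` on `X × Y` is a finite measure on a standard Borel space, so
it has a parameter (`exists_isParameter`), whose components are parameters of the two marginals.

Small box distance gives almost isometric maps (`exists_map_of_boxDist_lt`): let the parameters
`φ`, `ψ` have close pullback metrics on a large set `T`. Cut `X` into countably many small Borel
cells and send a cell that meets `φ '' T` to `ψ t`, for one `t ∈ T` with `φ t` in the cell. The
union of these cells is the large set, and `p (φ t)` is close to `ψ t` for all `t ∈ T`. Hence the
push forward of `μ` is close to `ν` on bounded Lipschitz functions, which determine weak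
convergence (`tendsto_of_forall_lipschitz_integral_tendsto`).

Conversely (`tendsto_boxDist_of_map`), cover `Y` up to a null set by disjoint open sets `Q i` of
small diameter (`exists_open_partition`); finitely many of them carry almost all of `ν`. By the
portmanteau theorem, `p n ⁻¹' Q i` eventually has at least almost the mass of `Q i`. So there is a
coupling that moves almost all mass from `p n ⁻¹' Q i` to `Q i` (`exists_coupling`). Almost every
pair `(x, y)` then has `y` close to `p n x`, and the distortion of the coupling is small on a large
set because `p n` is almost isometric on `A n`.
-/

namespace MMSpaces

/-! ### Parameters -/

theorem measurableEmbedding_coe_Icc (m : ℝ≥0) :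
    MeasurableEmbedding ((↑) : Set.Icc (0 : ℝ) m → ℝ) :=
  MeasurableEmbedding.subtype_coe measurableSet_Icc

theorem map_coe_lebesgueIcc (m : ℝ≥0) :
    (lebesgueIcc m).map ((↑) : Set.Icc (0 : ℝ) m → ℝ) = volume.restrict (Set.Icc (0 : ℝ) m) := by
  rw [lebesgueIcc, (measurableEmbedding_coe_Icc m).map_comap, Subtype.range_coe]

theorem lebesgueIcc_univ (m : ℝ≥0) : lebesgueIcc m Set.univ = m := by
  have h := congrArg (fun μ : Measure ℝ => μ Set.univ) (map_coe_lebesgueIcc m)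
  simpa [Measure.map_apply measurable_subtype_coe MeasurableSet.univ] using h

instance (m : ℝ≥0) : IsFiniteMeasure (lebesgueIcc m) :=
  ⟨by rw [lebesgueIcc_univ]; exact ENNReal.coe_lt_top⟩

/-- The rescaling `t ↦ t / m` of `[0, m]` onto the unit interval. -/
noncomputable def toUnitInterval (m : ℝ≥0) (t : Set.Icc (0 : ℝ) m) : unitInterval :=
  ⟨(m : ℝ)⁻¹ * t, mul_nonneg (by positivity) t.2.1, by
    rcases eq_or_ne m 0 with rfl | hm
    · simp
    · exact (inv_mul_le_one₀ (by positivity)).2 t.2.2⟩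

theorem measurable_toUnitInterval (m : ℝ≥0) : Measurable (toUnitInterval m) :=
  (measurable_subtype_coe.const_mul _).subtype_mk

theorem map_toUnitInterval_lebesgueIcc {m : ℝ≥0} (hm : m ≠ 0) :
    (lebesgueIcc m).map (toUnitInterval m) = (m : ℝ≥0∞) • (volume : Measure unitInterval) := by
  have hm' : (m : ℝ) ≠ 0 := by exact_mod_cast hm
  have hpos : (0 : ℝ) < m := lt_of_le_of_ne m.2 hm'.symm
  have key : ((lebesgueIcc m).map (toUnitInterval m)).map ((↑) : unitInterval → ℝ) =
      ((m : ℝ≥0∞) • (volume : Measure unitInterval)).map ((↑) : unitInterval → ℝ) := by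
    have hmeas : Measurable fun x : ℝ => (m : ℝ)⁻¹ * x := measurable_const_mul _
    have hpre : Set.Icc (0 : ℝ) m = (fun x : ℝ => (m : ℝ)⁻¹ * x) ⁻¹' Set.Icc 0 1 := by
      ext x
      simp only [Set.mem_Icc, Set.mem_preimage]
      rw [inv_mul_le_one₀ hpos, mul_nonneg_iff_of_pos_left (inv_pos.2 hpos)]
    rw [Measure.map_map measurable_subtype_coe (measurable_toUnitInterval m), Measure.map_smul,
      unitInterval.measurePreserving_coe.map_eq]
    have : ((↑) : unitInterval → ℝ) ∘ toUnitInterval m =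
        (fun x : ℝ => (m : ℝ)⁻¹ * x) ∘ ((↑) : Set.Icc (0 : ℝ) m → ℝ) := rfl
    rw [this, ← Measure.map_map hmeas measurable_subtype_coe, map_coe_lebesgueIcc, hpre,
      ← Measure.restrict_map hmeas measurableSet_Icc, Real.map_volume_mul_left (inv_ne_zero hm'),
      Measure.restrict_smul]
    simp [abs_of_pos hpos]
  ext s hs
  have h := congrArg (fun μ : Measure ℝ => μ ((↑) '' s)) key
  have hs' : MeasurableSet (((↑) : unitInterval → ℝ) '' s) :=
    unitInterval.measurableEmbedding_coe.measurableSet_image.2 hs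
  simpa only [Measure.map_apply measurable_subtype_coe hs',
    Set.preimage_image_eq _ Subtype.val_injective] using h

/-- Every finite measure on a nonempty standard Borel space has a parameter. -/
theorem exists_isParameter {Z : Type*} [MeasurableSpace Z] [StandardBorelSpace Z] [Nonempty Z]
    (π : FiniteMeasure Z) {m : ℝ≥0} (hm : m = π.mass) :
    ∃ φ : Set.Icc (0 : ℝ) m → Z, IsParameter π φ := by
  subst hm
  rcases eq_or_ne π 0 with rfl | hπ
  · refine ⟨fun _ => Classical.arbitrary Z, rfl, measurable_const, ?_⟩
    have h0 : lebesgueIcc (0 : FiniteMeasure Z).mass = 0 := by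
      rw [← Measure.measure_univ_eq_zero, lebesgueIcc_univ]
      simp
    rw [h0, Measure.map_zero]
    rfl
  · obtain ⟨f, hf, hfπ⟩ := Measure.exists_measurable_map_eq (π.normalize : Measure Z)
    refine ⟨f ∘ toUnitInterval _, rfl, hf.comp (measurable_toUnitInterval _), ?_⟩
    rw [← Measure.map_map hf (measurable_toUnitInterval _),
      map_toUnitInterval_lebesgueIcc (π.mass_nonzero_iff.2 hπ), Measure.map_smul, hfπ]
    conv_rhs => rw [π.self_eq_mass_smul_normalize]
    rfl

/-! ### Couplings -/

section Coupling

variable {X Y : Type*} [MeasurableSpace X] [MeasurableSpace Y]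

/-- A measure on `X × Y` whose marginals are dominated by `μ` and `ν`, two measures of the same
finite mass, extends to a coupling of `μ` and `ν`: add the normalized product of the two
residual marginals. -/
theorem exists_coupling_ge {μ : Measure X} {ν : Measure Y} [IsFiniteMeasure μ] [IsFiniteMeasure ν]
    (h : μ Set.univ = ν Set.univ) {σ : Measure (X × Y)} (hμ : σ.fst ≤ μ) (hν : σ.snd ≤ ν) :
    ∃ π : Measure (X × Y), σ ≤ π ∧ π.fst = μ ∧ π.snd = ν := by
  have hσfin : IsFiniteMeasure σ.fst := isFiniteMeasure_of_le μ hμ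
  have hσfin' : IsFiniteMeasure σ.snd := isFiniteMeasure_of_le ν hν
  have hμ' := Measure.sub_add_cancel_of_le hμ
  have hν' := Measure.sub_add_cancel_of_le hν
  have hmass : (μ - σ.fst) Set.univ = (ν - σ.snd) Set.univ := by
    rw [Measure.sub_apply MeasurableSet.univ hμ, Measure.sub_apply MeasurableSet.univ hν,
      Measure.fst_univ, Measure.snd_univ, h]
  have hfin₁ : IsFiniteMeasure (μ - σ.fst) := isFiniteMeasure_of_le μ Measure.sub_le
  have hfin₂ : IsFiniteMeasure (ν - σ.snd) := isFiniteMeasure_of_le ν Measure.sub_le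
  generalize hμ₁ : μ - σ.fst = μ₁ at *
  generalize hν₁ : ν - σ.snd = ν₁ at *
  refine ⟨σ + (μ₁ Set.univ)⁻¹ • μ₁.prod ν₁, Measure.le_add_right le_rfl, ?_, ?_⟩
  · rw [Measure.fst, Measure.map_add _ _ measurable_fst, Measure.map_smul, Measure.map_fst_prod,
      smul_smul, ← hmass, ← Measure.fst]
    rcases eq_or_ne (μ₁ Set.univ) 0 with h0 | h0
    · rw [Measure.measure_univ_eq_zero.1 h0] at hμ' ⊢
      simpa using hμ'
    · rw [ENNReal.inv_mul_cancel h0 (measure_ne_top _ _), one_smul, add_comm, hμ']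
  · rw [Measure.snd, Measure.map_add _ _ measurable_snd, Measure.map_smul, Measure.map_snd_prod,
      smul_smul, hmass, ← Measure.snd]
    rcases eq_or_ne (ν₁ Set.univ) 0 with h0 | h0
    · rw [Measure.measure_univ_eq_zero.1 h0] at hν' ⊢
      simpa using hν'
    · rw [ENNReal.inv_mul_cancel h0 (measure_ne_top _ _), one_smul, add_comm, hν']

/-- Two measures of the same finite mass have a coupling which moves, for each `i`, as much mass as
possible from `P i` to `Q i`, where `P` and `Q` are disjoint families. -/
theorem exists_coupling {ι : Type*} [Countable ι] (μ : Measure X) (ν : Measure Y)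
    [IsFiniteMeasure μ] [IsFiniteMeasure ν] (h : μ Set.univ = ν Set.univ)
    {P : ι → Set X} {Q : ι → Set Y} (hP : ∀ i, MeasurableSet (P i))
    (hQ : ∀ i, MeasurableSet (Q i)) (hPd : Pairwise (Function.onFun Disjoint P))
    (hQd : Pairwise (Function.onFun Disjoint Q)) :
    ∃ π : Measure (X × Y), π.fst = μ ∧ π.snd = ν ∧
      ∑' i, min (μ (P i)) (ν (Q i)) ≤ π (⋃ i, P i ×ˢ Q i) := by
  -- The factor makes the `i`-th summand a measure of mass `min (μ (P i)) (ν (Q i))`.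
  let c : ι → ℝ≥0∞ := fun i => (max (μ (P i)) (ν (Q i)))⁻¹
  let σ : Measure (X × Y) :=
    Measure.sum fun i => c i • (μ.restrict (P i)).prod (ν.restrict (Q i))
  have hc₁ : ∀ i, c i * ν (Q i) ≤ 1 := fun i => by
    rw [mul_comm, ← div_eq_mul_inv]
    exact ENNReal.div_le_of_le_mul (by simp)
  have hc₂ : ∀ i, c i * μ (P i) ≤ 1 := fun i => by
    rw [mul_comm, ← div_eq_mul_inv]
    exact ENNReal.div_le_of_le_mul (by simp)
  have hσμ : σ.fst ≤ μ := by
    calc σ.fst ≤ Measure.sum fun i => μ.restrict (P i) := by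
          rw [Measure.fst, Measure.map_sum measurable_fst.aemeasurable]
          refine Measure.le_intro fun s hs _ => ?_
          rw [Measure.sum_apply _ hs, Measure.sum_apply _ hs]
          refine ENNReal.tsum_le_tsum fun i => ?_
          rw [Measure.map_smul, Measure.map_fst_prod, smul_smul, Measure.restrict_apply_univ,
            Measure.smul_apply, smul_eq_mul]
          exact mul_le_of_le_one_left' (hc₁ i)
      _ = μ.restrict (⋃ i, P i) := (Measure.restrict_iUnion hPd hP).symm
      _ ≤ μ := Measure.restrict_le_self
  have hσν : σ.snd ≤ ν := by
    calc σ.snd ≤ Measure.sum fun i => ν.restrict (Q i) := by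
          rw [Measure.snd, Measure.map_sum measurable_snd.aemeasurable]
          refine Measure.le_intro fun s hs _ => ?_
          rw [Measure.sum_apply _ hs, Measure.sum_apply _ hs]
          refine ENNReal.tsum_le_tsum fun i => ?_
          rw [Measure.map_smul, Measure.map_snd_prod, smul_smul, Measure.restrict_apply_univ,
            Measure.smul_apply, smul_eq_mul]
          exact mul_le_of_le_one_left' (hc₂ i)
      _ = ν.restrict (⋃ i, Q i) := (Measure.restrict_iUnion hQd hQ).symm
      _ ≤ ν := Measure.restrict_le_self
  obtain ⟨π, hσπ, hπμ, hπν⟩ := exists_coupling_ge h hσμ hσν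
  refine ⟨π, hπμ, hπν, le_trans ?_ (hσπ _)⟩
  rw [Measure.sum_apply _ (MeasurableSet.iUnion fun i => (hP i).prod (hQ i))]
  refine ENNReal.tsum_le_tsum fun i => ?_
  calc min (μ (P i)) (ν (Q i)) ≤ c i * (μ (P i) * ν (Q i)) := by
        rw [← min_mul_max (μ (P i)) (ν (Q i)), mul_comm (min _ _), ← mul_assoc]
        rcases eq_or_ne (max (μ (P i)) (ν (Q i))) 0 with h0 | h0
        · have : min (μ (P i)) (ν (Q i)) ≤ 0 := h0 ▸ min_le_max
          exact this.trans zero_le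
        · rw [ENNReal.inv_mul_cancel h0
            (max_lt (measure_lt_top _ _) (measure_lt_top _ _)).ne, one_mul]
    _ = (c i • (μ.restrict (P i)).prod (ν.restrict (Q i))) (P i ×ˢ Q i) := by
        simp [Measure.prod_prod]
    _ ≤ _ := measure_mono (Set.subset_iUnion (fun i => P i ×ˢ Q i) i)

end Coupling

/-! ### Rescaling a measure to a smaller mass -/

section ScaleMass

variable {X : Type*} [MeasurableSpace X]

/-- The multiple of the finite measure `μ` that has mass `m`. (It is zero if `μ` is zero.) -/
noncomputable def scaleMass (m : ℝ≥0) (μ : FiniteMeasure X) : FiniteMeasure X :=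
  (m / μ.mass) • μ

theorem measureReal_univ_eq_mass (μ : FiniteMeasure X) :
    (μ : Measure X).real Set.univ = μ.mass := by
  rw [FiniteMeasure.measureReal_eq_coe_coeFn]
  rfl

theorem scaleMass_self (μ : FiniteMeasure X) : scaleMass μ.mass μ = μ := by
  rcases eq_or_ne μ 0 with rfl | h
  · simp [scaleMass]
  · rw [scaleMass, div_self (μ.mass_nonzero_iff.2 h), one_smul]

theorem scaleMass_apply (m : ℝ≥0) (μ : FiniteMeasure X) (s : Set X) :
    scaleMass m μ s = m / μ.mass * μ s := by
  rw [scaleMass, FiniteMeasure.smul_apply, smul_eq_mul]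

theorem mass_scaleMass {m : ℝ≥0} {μ : FiniteMeasure X} (h : m ≤ μ.mass) :
    (scaleMass m μ).mass = m := by
  rw [FiniteMeasure.mass, scaleMass_apply, ← FiniteMeasure.mass]
  rcases eq_or_ne μ.mass 0 with h0 | h0
  · rw [h0] at h ⊢
    simpa using h.antisymm' zero_le
  · exact div_mul_cancel₀ _ h0

theorem scaleMass_apply_le {m : ℝ≥0} {μ : FiniteMeasure X} (h : m ≤ μ.mass) (s : Set X) :
    scaleMass m μ s ≤ μ s := by
  rw [scaleMass_apply]
  exact mul_le_of_le_one_left' (div_le_one_of_le₀ h zero_le)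

/-- Rescaling removes at most the difference of the masses from any set. -/
theorem apply_le_scaleMass_add {m : ℝ≥0} {μ : FiniteMeasure X} (h : m ≤ μ.mass) (s : Set X) :
    μ s ≤ scaleMass m μ s + (μ.mass - m) := by
  have h1 : m / μ.mass * μ.mass = m := by
    simpa only [scaleMass_apply, FiniteMeasure.mass] using mass_scaleMass h
  have h2 : m / μ.mass ≤ 1 := div_le_one_of_le₀ h zero_le
  have h3 := μ.apply_le_mass s
  rw [scaleMass_apply]
  generalize m / μ.mass = c at *
  have h1' : (c : ℝ) * μ.mass = m := by exact_mod_cast h1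
  rw [← NNReal.coe_le_coe] at h2 h3 ⊢
  rw [NNReal.coe_add, NNReal.coe_mul, NNReal.coe_sub h]
  rw [NNReal.coe_one] at h2
  nlinarith

theorem abs_integral_sub_integral_scaleMass_le {m : ℝ≥0} {μ : FiniteMeasure X} (h : m ≤ μ.mass)
    {g : X → ℝ} {C : ℝ} (hg : ∀ x, |g x| ≤ C) :
    |∫ x, g x ∂(μ : Measure X) - ∫ x, g x ∂(scaleMass m μ : Measure X)| ≤ C * (μ.mass - m) := by
  have h1 : m / μ.mass * μ.mass = m := by
    simpa only [scaleMass_apply, FiniteMeasure.mass] using mass_scaleMass h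
  have h2 : m / μ.mass ≤ 1 := div_le_one_of_le₀ h zero_le
  have h3 : |∫ x, g x ∂(μ : Measure X)| ≤ C * μ.mass := by
    have h4 := norm_integral_le_of_norm_le_const (μ := (μ : Measure X)) (f := g) (.of_forall hg)
    rwa [measureReal_univ_eq_mass, Real.norm_eq_abs] at h4
  rw [scaleMass, FiniteMeasure.toMeasure_smul, integral_smul_nnreal_measure, NNReal.smul_def,
    smul_eq_mul]
  generalize m / μ.mass = c at *
  have h1' : (c : ℝ) * μ.mass = m := by exact_mod_cast h1
  have h2' : (c : ℝ) ≤ 1 := by exact_mod_cast h2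
  generalize ∫ x, g x ∂(μ : Measure X) = I at *
  calc |I - c * I| = (1 - c) * |I| := by
        rw [← one_sub_mul, abs_mul, abs_of_nonneg (sub_nonneg.2 h2')]
    _ ≤ (1 - c) * (C * μ.mass) := mul_le_mul_of_nonneg_left h3 (sub_nonneg.2 h2')
    _ = C * (μ.mass - m) := by rw [← h1']; ring

end ScaleMass

/-! ### The box distance -/

section BoxDist

variable {X Y : Type*} [MetricSpace X] [MeasurableSpace X] [MetricSpace Y] [MeasurableSpace Y]

/-- The three cases in the definition of the box distance have a common form. -/
theorem boxDist_eq (lam : ℝ≥0) (μ : FiniteMeasure X) (ν : FiniteMeasure Y) {m : ℝ≥0}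
    (hm : m = min μ.mass ν.mass) :
    boxDist lam μ ν = boxDistEqMass lam m (scaleMass m μ) (scaleMass m ν) +
      ((μ.mass - m + (ν.mass - m) : ℝ≥0) : ℝ≥0∞) := by
  subst hm
  unfold boxDist
  split_ifs with h1 h2
  · conv_rhs => rw [← h1, min_self, scaleMass_self, h1, scaleMass_self]
    simp [h1]
  · rw [min_eq_left h2.le, scaleMass_self, tsub_self, zero_add]
    rfl
  · rw [min_eq_right (not_lt.1 h2), scaleMass_self, tsub_self, add_zero]
    rfl

variable [CompleteSpace X] [TopologicalSpace.SeparableSpace X] [Nonempty X] [BorelSpace X]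
  [CompleteSpace Y] [TopologicalSpace.SeparableSpace Y] [Nonempty Y] [BorelSpace Y]

/-- A coupling that is concentrated, up to mass `ε`, on a set of pairs with distortion at most `ε`
bounds the box distance: the components of a parameter of the coupling are parameters of its
marginals. -/
theorem boxDistEqMass_le_of_coupling {μ : FiniteMeasure X} {ν : FiniteMeasure Y} {m : ℝ≥0}
    (hμ : m = μ.mass) (hν : m = ν.mass) {π : Measure (X × Y)} (hπμ : π.fst = μ) (hπν : π.snd = ν)
    {ε : ℝ≥0} (hε : 0 < ε) {S : Set (X × Y)} (hS : MeasurableSet S)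
    (hSm : (m : ℝ≥0∞) ≤ π S + ε)
    (hSd : ∀ z ∈ S, ∀ w ∈ S, |dist z.1 w.1 - dist z.2 w.2| ≤ ε) :
    boxDistEqMass 1 m μ ν ≤ ε := by
  have hX : SecondCountableTopology X := UniformSpace.secondCountable_of_separable X
  have hY : SecondCountableTopology Y := UniformSpace.secondCountable_of_separable Y
  have hπm : π Set.univ = m := by
    rw [← Measure.fst_univ, hπμ, hμ, FiniteMeasure.ennreal_mass]
  let π' : FiniteMeasure (X × Y) := ⟨π, ⟨by rw [hπm]; exact ENNReal.coe_lt_top⟩⟩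
  have hπ'm : m = π'.mass := by
    rw [← ENNReal.coe_inj, FiniteMeasure.ennreal_mass]
    exact hπm.symm
  obtain ⟨χ, -, hχ, hχπ⟩ := exists_isParameter π' hπ'm
  have hχπ' : (lebesgueIcc m).map χ = π := hχπ
  refine sInf_le_of_le ⟨fun t => (χ t).1, fun t => (χ t).2, ⟨hμ, hχ.fst, ?_⟩, ⟨hν, hχ.snd, ?_⟩, rfl⟩
    (sInf_le ⟨ε, hε, rfl, χ ⁻¹' S, hχ hS, ?_, fun s hs t ht => hSd _ hs _ ht⟩)
  · rw [← hπμ, Measure.fst, ← hχπ', Measure.map_map measurable_fst hχ]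
    rfl
  · rw [← hπν, Measure.snd, ← hχπ', Measure.map_map measurable_snd hχ]
    rfl
  · rw [lebesgueIcc_univ, ← Measure.map_apply hχ hS, hχπ', ENNReal.coe_one, one_mul]
    exact hSm

theorem boxDist_lt_top (μ : FiniteMeasure X) (ν : FiniteMeasure Y) : boxDist 1 μ ν < ∞ := by
  rw [boxDist_eq 1 μ ν rfl]
  set m := min μ.mass ν.mass
  have hμ : m = (scaleMass m μ).mass := (mass_scaleMass (min_le_left _ _)).symm
  have hν : m = (scaleMass m ν).mass := (mass_scaleMass (min_le_right _ _)).symm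
  obtain ⟨π, hπμ, hπν, -⟩ := exists_coupling (ι := Empty) (scaleMass m μ : Measure X)
    (scaleMass m ν : Measure Y) (by rw [← FiniteMeasure.ennreal_mass, ← FiniteMeasure.ennreal_mass,
      ← hμ, ← hν]) (P := fun _ => ∅) (Q := fun _ => ∅) nofun nofun nofun nofun
  refine ENNReal.add_lt_top.2 ⟨lt_of_le_of_lt (boxDistEqMass_le_of_coupling hμ hν hπμ hπν
    (ε := m + 1) (by positivity) MeasurableSet.empty ?_ (by simp)) ENNReal.coe_lt_top,
    ENNReal.coe_lt_top⟩
  rw [measure_empty, zero_add]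
  exact_mod_cast le_self_add

end BoxDist

/-! ### From the box distance to an almost isometric map -/

/-- A separable metric space has a countable Borel partition into cells of diameter at most `ε`,
given here as the fibres of a measurable index function. -/
theorem exists_measurable_index {X : Type*} [MetricSpace X] [TopologicalSpace.SeparableSpace X]
    [MeasurableSpace X] [BorelSpace X] {ε : ℝ} (hε : 0 < ε) :
    ∃ i : X → ℕ, Measurable i ∧ ∀ x y, i x = i y → dist x y ≤ ε := by
  obtain ⟨B, hB, hBb, hBd, hBu, -⟩ := SeparableSpace.exists_measurable_partition_diam_le X hε
  have hcov : ∀ x, ∃ n, x ∈ B n := fun x => by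
    rw [← Set.mem_iUnion, hBu]
    trivial
  classical
  refine ⟨fun x => Nat.find (hcov x), measurable_find hcov hB, fun x y h => ?_⟩
  have hy := Nat.find_spec (hcov y)
  rw [← show Nat.find (hcov x) = Nat.find (hcov y) from h] at hy
  exact (Metric.dist_le_diam_of_mem (hBb _) (Nat.find_spec (hcov x)) hy).trans (hBd _)

/-- If `u` and `v` are close outside a set of small measure, a bounded Lipschitz function has
almost the same integral against their laws. -/
theorem abs_integral_sub_integral_le {S Y : Type*} [MeasurableSpace S] [MetricSpace Y]
    [Nonempty Y] [MeasurableSpace Y] [BorelSpace Y]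
    (τ : Measure S) [IsFiniteMeasure τ] {u v : S → Y}
    (hu : Measurable u) (hv : Measurable v) {T : Set S} (hT : MeasurableSet T) {δ ε : ℝ}
    (hδ : 0 ≤ δ) (hTε : τ.real Tᶜ ≤ ε) (hd : ∀ t ∈ T, dist (u t) (v t) ≤ δ)
    {f : Y → ℝ} {C : ℝ} (hC : ∀ y, |f y| ≤ C) {L : ℝ≥0} (hL : LipschitzWith L f) :
    |∫ t, f (u t) ∂τ - ∫ t, f (v t) ∂τ| ≤ 2 * C * ε + L * δ * τ.real Set.univ := by
  have hint : ∀ w : S → Y, Measurable w → Integrable (fun t => f (w t)) τ := fun w hw =>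
    .of_bound (hL.continuous.measurable.comp hw).aestronglyMeasurable C (.of_forall fun t => hC _)
  have hI : Integrable (fun t => f (u t) - f (v t)) τ := (hint u hu).sub (hint v hv)
  have h1 : |∫ t in T, (f (u t) - f (v t)) ∂τ| ≤ L * δ * τ.real T :=
    norm_setIntegral_le_of_norm_le_const (μ := τ) (f := fun t => f (u t) - f (v t))
      (measure_lt_top _ _) fun t ht =>
      (hL.dist_le_mul _ _).trans (mul_le_mul_of_nonneg_left (hd t ht) L.2)
  have h2 : |∫ t in Tᶜ, (f (u t) - f (v t)) ∂τ| ≤ 2 * C * τ.real Tᶜ :=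
    norm_setIntegral_le_of_norm_le_const (μ := τ) (f := fun t => f (u t) - f (v t))
      (measure_lt_top _ _) fun t _ =>
      (abs_sub _ _).trans (by linarith [hC (u t), hC (v t)])
  rw [← integral_sub (hint u hu) (hint v hv), ← integral_add_compl hT hI]
  have hTu : τ.real T ≤ τ.real Set.univ := measureReal_mono (Set.subset_univ T)
  have hC0 : 0 ≤ C := (abs_nonneg _).trans (hC (Classical.arbitrary Y))
  calc _ ≤ _ := abs_add_le _ _
    _ ≤ L * δ * τ.real T + 2 * C * τ.real Tᶜ := add_le_add h1 h2
    _ ≤ L * δ * τ.real Set.univ + 2 * C * ε := by gcongr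
    _ = _ := add_comm _ _

section ToMap

variable {X Y : Type*} [MetricSpace X] [MeasurableSpace X] [MetricSpace Y] [MeasurableSpace Y]
  [TopologicalSpace.SeparableSpace X] [BorelSpace X]
  [Nonempty Y] [BorelSpace Y]

/-- A small box distance yields a Borel map that is almost isometric on a large set, and whose push
forward of `μ` is close to `ν` when tested on bounded Lipschitz functions. Given parameters `φ`,
`ψ` and a large set `T` on which their pullback metrics are close, the map sends each small cell of
`X` that meets `φ '' T` to a single point of `ψ '' T`. A countable Borel partition makes the map
and its good set Borel, although `φ '' T` itself need not be. -/
theorem exists_map_of_boxDist_lt (μ : FiniteMeasure X) (ν : FiniteMeasure Y) {e : ℝ}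
    (h : boxDist 1 μ ν < ENNReal.ofReal e) :
    ∃ (p : X → Y) (A : Set X), Measurable p ∧ MeasurableSet A ∧
      (μ : Measure X) Aᶜ ≤ ENNReal.ofReal e ∧
      (∀ x ∈ A, ∀ y ∈ A, |dist x y - dist (p x) (p y)| ≤ 3 * e) ∧
      ∀ (f : Y → ℝ) (C : ℝ) (L : ℝ≥0), (∀ y, |f y| ≤ C) → LipschitzWith L f →
        |∫ y, f y ∂(μ.map p : Measure Y) - ∫ y, f y ∂(ν : Measure Y)| ≤
          (3 * C + 2 * L * ν.mass) * e := by
  rw [boxDist_eq 1 μ ν rfl] at h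
  set m := min μ.mass ν.mass with hm
  have hmμ : m ≤ μ.mass := min_le_left _ _
  have hmν : m ≤ ν.mass := min_le_right _ _
  obtain ⟨_, ⟨φ, ψ, ⟨-, hφ, hφμ⟩, ⟨-, hψ, hψν⟩, rfl⟩, h⟩ := sInf_lt_iff.1 (lt_tsub_iff_right.2 h)
  obtain ⟨_, ⟨ε, hε, rfl, T, hT, hTm, hTd⟩, h⟩ := sInf_lt_iff.1 h
  have hεe : (ε : ℝ) + ((μ.mass - m) + (ν.mass - m)) < e := by
    have h' := lt_tsub_iff_right.1 h
    rw [← ENNReal.coe_add, ← ENNReal.ofReal_coe_nnreal,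
      ENNReal.ofReal_lt_ofReal_iff_of_nonneg (NNReal.coe_nonneg _)] at h'
    simpa [NNReal.coe_sub hmμ, NNReal.coe_sub hmν] using h'
  have hε' : (0 : ℝ) < ε := hε
  have hmμ' : (m : ℝ) ≤ μ.mass := hmμ
  have hmν' : (m : ℝ) ≤ ν.mass := hmν
  have hTc : lebesgueIcc m Tᶜ ≤ ε := by
    rw [measure_compl hT (measure_ne_top _ _)]
    exact tsub_le_iff_left.2 (by simpa using hTm)
  obtain ⟨i, hi, hid⟩ := exists_measurable_index (X := X) hε'
  classical
  -- All points of a cell that meets `φ '' T` go to `ψ t`, for one `t ∈ T` with `φ t` in the cell.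
  let g : ℕ → Y := fun k =>
    if hk : ∃ t ∈ T, i (φ t) = k then ψ hk.choose else Classical.arbitrary Y
  let J : Set ℕ := {k | ∃ t ∈ T, i (φ t) = k}
  have hg : ∀ x, i x ∈ J → ∃ t ∈ T, g (i x) = ψ t ∧ dist x (φ t) ≤ ε := fun x hx =>
    ⟨hx.choose, hx.choose_spec.1, dif_pos hx, hid _ _ hx.choose_spec.2.symm⟩
  have hp : Measurable (g ∘ i) := (measurable_from_nat (f := g)).comp hi
  have hA : MeasurableSet (i ⁻¹' J) := hi (MeasurableSet.of_discrete)
  refine ⟨g ∘ i, i ⁻¹' J, hp, hA, ?_, fun x hx y hy => ?_, fun f C L hC hL => ?_⟩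
  · have h1 : (scaleMass m μ : Measure X) (i ⁻¹' J)ᶜ ≤ ε := by
      rw [← hφμ, Measure.map_apply hφ hA.compl]
      refine (measure_mono fun t ht htT => ?_).trans hTc
      exact ht ⟨t, htT, rfl⟩
    have h2 := apply_le_scaleMass_add hmμ (i ⁻¹' J)ᶜ
    rw [← FiniteMeasure.ennreal_coeFn_eq_coeFn_toMeasure, ENNReal.coe_le_coe] at h1
    rw [← FiniteMeasure.ennreal_coeFn_eq_coeFn_toMeasure, ← ENNReal.ofReal_coe_nnreal]
    refine ENNReal.ofReal_le_ofReal ?_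
    rw [← NNReal.coe_le_coe] at h1 h2
    rw [NNReal.coe_add, NNReal.coe_sub hmμ] at h2
    linarith
  · obtain ⟨s, hs, hgs, hds⟩ := hg x hx
    obtain ⟨t, ht, hgt, hdt⟩ := hg y hy
    have h1 := hTd s hs t ht
    have h2 := dist_dist_dist_le x y (φ s) (φ t)
    rw [Real.dist_eq] at h2
    simp only [Function.comp_apply, hgs, hgt]
    rw [abs_le] at *
    constructor <;> linarith
  · have hfm : Measurable f := hL.continuous.measurable
    rw [FiniteMeasure.toMeasure_map, integral_map hp.aemeasurable hfm.aestronglyMeasurable]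
    have h1 := abs_integral_sub_integral_scaleMass_le hmμ (g := fun x => f ((g ∘ i) x))
      fun x => hC _
    have h2 := abs_integral_sub_integral_scaleMass_le hmν hC
    rw [← hφμ, integral_map (f := fun x => f ((g ∘ i) x)) hφ.aemeasurable
      (hfm.comp hp).aestronglyMeasurable] at h1
    rw [← hψν, integral_map hψ.aemeasurable hfm.aestronglyMeasurable] at h2
    have h3 := abs_integral_sub_integral_le (lebesgueIcc m) (hp.comp hφ) hψ hT (δ := 2 * ε)
      (ε := ε) (by positivity) (ENNReal.toReal_le_coe_of_le_coe hTc) (fun t ht => by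
        obtain ⟨s, hs, hgs, hds⟩ := hg (φ t) ⟨t, ht, rfl⟩
        have h4 := hTd s hs t ht
        simp only [Function.comp_apply, hgs]
        rw [dist_comm] at hds
        rw [abs_le] at h4
        linarith) hC hL
    have hC0 : 0 ≤ C := (abs_nonneg _).trans (hC (Classical.arbitrary Y))
    have hu : (lebesgueIcc m).real Set.univ = m := by simp [Measure.real, lebesgueIcc_univ]
    rw [hu] at h3
    have h5 : 2 * C * ε + L * (2 * ε) * m ≤ 2 * C * e + 2 * L * ν.mass * e := by
      have : (ε : ℝ) ≤ e := by linarith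
      have he0 : 0 ≤ e := by linarith
      calc 2 * C * ε + L * (2 * ε) * m ≤ 2 * C * e + L * (2 * e) * ν.mass := by gcongr
        _ = _ := by ring
    have h6 : C * (μ.mass - m) + C * (ν.mass - m) ≤ C * e := by
      rw [← mul_add]
      exact mul_le_mul_of_nonneg_left (by linarith) hC0
    simp only [Function.comp_apply] at h1 h3 ⊢
    rw [abs_le] at *
    constructor <;> linarith

end ToMap

/-! ### Weak convergence of finite measures -/

section Weak

variable {Y ι : Type*} [MetricSpace Y] [MeasurableSpace Y] [BorelSpace Y]

/-- Bounded Lipschitz functions suffice to test the weak convergence of finite measures. -/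
theorem tendsto_of_forall_lipschitz_integral_tendsto [Nonempty Y] {F : Filter ι}
    [F.IsCountablyGenerated] {μs : ι → FiniteMeasure Y} {ν : FiniteMeasure Y}
    (h : ∀ (f : Y → ℝ) (C : ℝ) (L : ℝ≥0), (∀ y, |f y| ≤ C) → LipschitzWith L f →
      Tendsto (fun i => ∫ y, f y ∂(μs i : Measure Y)) F (𝓝 (∫ y, f y ∂(ν : Measure Y)))) :
    Tendsto μs F (𝓝 ν) := by
  have hmass : Tendsto (fun i => ((μs i).mass : ℝ)) F (𝓝 (ν.mass : ℝ)) := by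
    simpa [measureReal_univ_eq_mass] using h (fun _ => 1) 1 0 (by simp) (LipschitzWith.const 1)
  have hmass' : Tendsto (fun i => (μs i).mass) F (𝓝 ν.mass) := NNReal.tendsto_coe.1 hmass
  rcases eq_or_ne ν 0 with rfl | hν
  · exact FiniteMeasure.tendsto_zero_of_tendsto_zero_mass hmass'
  refine FiniteMeasure.tendsto_of_tendsto_normalize_testAgainstNN_of_tendsto_mass ?_ hmass'
  refine tendsto_iff_forall_lipschitz_integral_tendsto.2 fun f ⟨C, hC⟩ ⟨L, hL⟩ => ?_
  have hb : ∀ y, |f y| ≤ |f (Classical.arbitrary Y)| + C := fun y => by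
    have h1 := hC y (Classical.arbitrary Y)
    have h2 := abs_sub_abs_le_abs_sub (f y) (f (Classical.arbitrary Y))
    rw [Real.dist_eq] at h1
    linarith
  have hν0 : (ν.mass : ℝ) ≠ 0 := by exact_mod_cast ν.mass_nonzero_iff.2 hν
  have hlim := (hmass.inv₀ hν0).mul (h f _ L hb hL)
  rw [← FiniteMeasure.average_eq_integral_normalize ν hν, average_eq,
    measureReal_univ_eq_mass, smul_eq_mul]
  refine hlim.congr' ?_
  filter_upwards [hmass.eventually_ne hν0] with i hi
  rw [← FiniteMeasure.average_eq_integral_normalize (μs i)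
    ((μs i).mass_nonzero_iff.1 (by exact_mod_cast hi)), average_eq,
    measureReal_univ_eq_mass, smul_eq_mul]

/-- The lower bound for open sets in the portmanteau theorem, for finite measures. -/
theorem eventually_apply_le_add_of_tendsto {F : Filter ι} {μs : ι → FiniteMeasure Y}
    {ν : FiniteMeasure Y} (h : Tendsto μs F (𝓝 ν)) {G : Set Y} (hG : IsOpen G) {η : ℝ≥0}
    (hη : 0 < η) : ∀ᶠ i in F, ν G ≤ μs i G + η := by
  have hη2 : 0 < η / 2 := half_pos hη
  have h1 : limsup (fun i => (μs i : Measure Y) Gᶜ) F < (ν : Measure Y) Gᶜ + (η / 2 : ℝ≥0) :=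
    (FiniteMeasure.limsup_measure_closed_le_of_tendsto h hG.isClosed_compl).trans_lt
      (ENNReal.lt_add_right (measure_ne_top _ _) (by exact_mod_cast hη2.ne'))
  have h2 : ∀ᶠ i in F, ν.mass < (μs i).mass + η / 2 :=
    (h.mass.add_const _).eventually_const_lt (lt_add_of_pos_right _ hη2)
  filter_upwards [eventually_lt_of_limsup_lt h1, h2] with i hi1 hi2
  have hsplit : ∀ κ : FiniteMeasure Y, κ.mass = κ G + κ Gᶜ := fun κ => by
    rw [← ENNReal.coe_inj, ENNReal.coe_add, FiniteMeasure.ennreal_mass,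
      FiniteMeasure.ennreal_coeFn_eq_coeFn_toMeasure,
      FiniteMeasure.ennreal_coeFn_eq_coeFn_toMeasure, measure_add_measure_compl hG.measurableSet]
  rw [← FiniteMeasure.ennreal_coeFn_eq_coeFn_toMeasure,
    ← FiniteMeasure.ennreal_coeFn_eq_coeFn_toMeasure, ← ENNReal.coe_add, ENNReal.coe_lt_coe] at hi1
  rw [hsplit, hsplit] at hi2
  rw [← NNReal.coe_lt_coe] at hi1 hi2
  rw [← NNReal.coe_le_coe]
  push_cast at *
  linarith

/-- Up to a null set, a separable metric space is a countable disjoint union of open sets of small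
diameter: take balls with null boundary, and remove from each the closures of the earlier ones. -/
theorem exists_open_partition [TopologicalSpace.SeparableSpace Y] [Nonempty Y] (ν : Measure Y)
    [IsFiniteMeasure ν] {δ : ℝ} (hδ : 0 < δ) :
    ∃ Q : ℕ → Set Y, (∀ n, IsOpen (Q n)) ∧ Pairwise (Function.onFun Disjoint Q) ∧
      (∀ n, ∀ x ∈ Q n, ∀ y ∈ Q n, dist x y ≤ δ) ∧ ν (⋃ n, Q n)ᶜ = 0 := by
  have hr : ∀ n, ∃ r ∈ Set.Ioo (δ / 4) (δ / 2),
      ν (frontier (Metric.thickening r {TopologicalSpace.denseSeq Y n})) = 0 := fun n =>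
    exists_null_frontier_thickening ν _ (by linarith)
  choose r hr hrν using hr
  simp only [Metric.thickening_singleton] at hrν
  set B : ℕ → Set Y := fun n => Metric.ball (TopologicalSpace.denseSeq Y n) (r n) with hB
  refine ⟨fun n => B n \ ⋃ k ∈ Set.Iio n, closure (B k), fun n => ?_, ?_, fun n x hx y hy => ?_, ?_⟩
  · exact Metric.isOpen_ball.sdiff ((Set.finite_Iio n).isClosed_biUnion fun k _ => isClosed_closure)
  · refine (pairwise_disjoint_on _).2 fun k n hkn => Set.disjoint_left.2 fun x hx hx' => ?_
    exact hx'.2 (Set.mem_biUnion hkn (subset_closure hx.1))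
  · have h1 := Metric.mem_ball.1 hx.1
    have h2 := Metric.mem_ball.1 hy.1
    have h3 := dist_triangle_right x y (TopologicalSpace.denseSeq Y n)
    linarith [(hr n).2]
  · refine measure_mono_null (t := ⋃ n, frontier (B n)) (fun x hx => ?_)
      (measure_iUnion_null fun n => hrν n)
    by_contra hxf
    have hex : ∃ n, x ∈ B n := by
      obtain ⟨n, hn⟩ := (TopologicalSpace.denseRange_denseSeq Y).exists_dist_lt x
        (show 0 < δ / 4 by positivity)
      exact ⟨n, Metric.mem_ball.2 (hn.trans (hr n).1)⟩
    classical
    -- The point lies in the first ball that contains it, and not in the closures of earlier ones.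
    refine hx (Set.mem_iUnion.2 ⟨Nat.find hex, Nat.find_spec hex, fun hmem => ?_⟩)
    obtain ⟨k, hk, hxk⟩ := Set.mem_iUnion₂.1 hmem
    rw [closure_eq_self_union_frontier] at hxk
    rcases hxk with hxk | hxk
    · exact Nat.find_min hex hk hxk
    · exact hxf (Set.mem_iUnion.2 ⟨k, hxk⟩)

end Weak

/-! ### From an almost isometric map to the box distance -/

section OfMap

variable {X Y : Type*} [MetricSpace X] [MeasurableSpace X] [MetricSpace Y] [MeasurableSpace Y]
  [CompleteSpace X] [TopologicalSpace.SeparableSpace X] [Nonempty X] [BorelSpace X]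
  [CompleteSpace Y] [TopologicalSpace.SeparableSpace Y] [Nonempty Y] [BorelSpace Y]

/-- Quantitative bound for the box distance, from a map `p : X → Y` with distortion at most `ε` on
`A`. The hypothesis `hη` says that `p` transports `μ` to `ν` with error `η` at the resolution given
by the sets `Q i`. The coupling that matches `p ⁻¹' Q i` with `Q i` moves most points `x` to points
at distance at most `δ` from `p x`; `D` accounts for the difference of the masses. -/
theorem boxDist_le_of_map {μ : FiniteMeasure X} {ν : FiniteMeasure Y} {m D : ℝ≥0}
    (hm : m = min μ.mass ν.mass) (hD : D = (μ.mass - m) + (ν.mass - m))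
    {p : X → Y} (hp : Measurable p) {A : Set X} (hA : MeasurableSet A) {ε δ η : ℝ≥0}
    (hδ : 0 < δ) (hAε : μ Aᶜ ≤ ε)
    (hpA : ∀ x ∈ A, ∀ y ∈ A, |dist x y - dist (p x) (p y)| ≤ ε) {Q : ℕ → Set Y}
    (hQ : ∀ n, MeasurableSet (Q n)) (hQd : Pairwise (Function.onFun Disjoint Q))
    (hQδ : ∀ n, ∀ x ∈ Q n, ∀ y ∈ Q n, dist x y ≤ δ) {k : ℕ}
    (hη : ν.mass ≤ ∑ i ∈ Finset.range k, min (μ (p ⁻¹' Q i)) (ν (Q i)) + η) :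
    boxDist 1 μ ν ≤ ((ε + 2 * δ + η + k * D) + D : ℝ≥0) := by
  have hmμ : m ≤ μ.mass := hm ▸ min_le_left _ _
  have hmν : m ≤ ν.mass := hm ▸ min_le_right _ _
  have hμ : m = (scaleMass m μ).mass := (mass_scaleMass hmμ).symm
  have hν : m = (scaleMass m ν).mass := (mass_scaleMass hmν).symm
  rw [boxDist_eq 1 μ ν hm, ← hD, ENNReal.coe_add]
  refine add_le_add ?_ le_rfl
  obtain ⟨π, hπμ, hπν, hπ⟩ := exists_coupling (scaleMass m μ : Measure X)
    (scaleMass m ν : Measure Y) (by rw [← FiniteMeasure.ennreal_mass, ← FiniteMeasure.ennreal_mass,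
      ← hμ, ← hν]) (fun i => hp (hQ i)) hQ (fun i j hij => (hQd hij).preimage p) hQd
  set U : Set (X × Y) := ⋃ i, (p ⁻¹' Q i) ×ˢ Q i with hU
  have hUm : MeasurableSet U := MeasurableSet.iUnion fun i => (hp (hQ i)).prod (hQ i)
  refine boxDistEqMass_le_of_coupling hμ hν hπμ hπν (by positivity)
    (S := U ∩ Prod.fst ⁻¹' A) (hUm.inter (measurable_fst hA)) ?_ ?_
  · have hterm : ∀ i, min (μ (p ⁻¹' Q i)) (ν (Q i)) ≤
        min (scaleMass m μ (p ⁻¹' Q i)) (scaleMass m ν (Q i)) + D := fun i => by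
      rw [← min_add_add_right]
      refine min_le_min ((apply_le_scaleMass_add hmμ _).trans ?_)
        ((apply_le_scaleMass_add hmν _).trans ?_)
      · rw [hD]
        gcongr
        exact le_self_add
      · rw [hD]
        gcongr
        exact le_add_self
    have hsum : m ≤ ∑ i ∈ Finset.range k,
        min (scaleMass m μ (p ⁻¹' Q i)) (scaleMass m ν (Q i)) + (η + k * D) := by
      refine hmν.trans (hη.trans ?_)
      calc _ ≤ ∑ i ∈ Finset.range k,
            (min (scaleMass m μ (p ⁻¹' Q i)) (scaleMass m ν (Q i)) + D) + η := by
            gcongr with i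
            exact hterm i
        _ = _ := by
            rw [Finset.sum_add_distrib, Finset.sum_const, Finset.card_range, nsmul_eq_mul]
            ring
    have hsum' : ((∑ i ∈ Finset.range k,
        min (scaleMass m μ (p ⁻¹' Q i)) (scaleMass m ν (Q i)) : ℝ≥0) : ℝ≥0∞) ≤ π U := by
      refine le_trans ?_ hπ
      refine le_trans (le_of_eq ?_) (ENNReal.sum_le_tsum (Finset.range k))
      simp only [ENNReal.ofNNReal_finsetSum, ENNReal.coe_min,
        FiniteMeasure.ennreal_coeFn_eq_coeFn_toMeasure]
    have hAc : π (Prod.fst ⁻¹' Aᶜ) ≤ ε := by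
      rw [← Measure.fst_apply hA.compl, hπμ, ← FiniteMeasure.ennreal_coeFn_eq_coeFn_toMeasure]
      exact_mod_cast (scaleMass_apply_le hmμ _).trans hAε
    have hsplit : π U ≤ π (U ∩ Prod.fst ⁻¹' A) + ε :=
      calc π U ≤ π (U ∩ Prod.fst ⁻¹' A ∪ Prod.fst ⁻¹' Aᶜ) := measure_mono fun z hz => by
            by_cases hzA : z.1 ∈ A
            · exact Or.inl ⟨hz, hzA⟩
            · exact Or.inr hzA
        _ ≤ _ := (measure_union_le _ _).trans (add_le_add le_rfl hAc)
    calc (m : ℝ≥0∞) ≤ π U + (η + k * D : ℝ≥0) := by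
          refine (ENNReal.coe_le_coe.2 hsum).trans ?_
          rw [ENNReal.coe_add]
          exact add_le_add hsum' le_rfl
      _ ≤ π (U ∩ Prod.fst ⁻¹' A) + ε + (η + k * D : ℝ≥0) := add_le_add hsplit le_rfl
      _ ≤ π (U ∩ Prod.fst ⁻¹' A) + (ε + 2 * δ + η + k * D : ℝ≥0) := by
          rw [add_assoc, ← ENNReal.coe_add]
          refine add_le_add le_rfl (ENNReal.coe_le_coe.2 ?_)
          rw [add_assoc (ε + 2 * δ)]
          exact add_le_add le_self_add le_rfl
  · rintro ⟨x, y⟩ ⟨hxy, hx⟩ ⟨x', y'⟩ ⟨hxy', hx'⟩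
    have hnear : ∀ x y, (x, y) ∈ U → dist (p x) y ≤ δ := fun x y h => by
      obtain ⟨i, hi⟩ := Set.mem_iUnion.1 h
      exact hQδ i _ hi.1 _ hi.2
    have h1 := hpA x hx x' hx'
    have h2 := dist_dist_dist_le (p x) (p x') y y'
    rw [Real.dist_eq] at h2
    have h3 := hnear x y hxy
    have h4 := hnear x' y' hxy'
    have h5 : (0 : ℝ) ≤ η + k * D := by positivity
    push_cast
    rw [abs_le] at *
    constructor <;> linarith

theorem tendsto_boxDist_of_map {X : ℕ → Type*} [∀ n, MetricSpace (X n)]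
    [∀ n, CompleteSpace (X n)] [∀ n, TopologicalSpace.SeparableSpace (X n)] [∀ n, Nonempty (X n)]
    [∀ n, MeasurableSpace (X n)] [∀ n, BorelSpace (X n)]
    {μ : ∀ n, FiniteMeasure (X n)} {ν : FiniteMeasure Y} {p : ∀ n, X n → Y} {A : ∀ n, Set (X n)}
    {ε : ℕ → ℝ} (hp : ∀ n, Measurable (p n)) (hA : ∀ n, MeasurableSet (A n))
    (hε : Tendsto ε atTop (𝓝 0))
    (hAε : ∀ n, (μ n : Measure (X n)) (A n)ᶜ ≤ ENNReal.ofReal (ε n))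
    (hpA : ∀ n, ∀ x ∈ A n, ∀ y ∈ A n, |dist x y - dist (p n x) (p n y)| ≤ ε n)
    (hlim : Tendsto (fun n => (μ n).map (p n)) atTop (𝓝 ν)) :
    Tendsto (fun n => boxDist 1 (μ n) ν) atTop (𝓝 0) := by
  refine ENNReal.tendsto_nhds_zero.2 fun e he => ?_
  obtain ⟨e', he', hee⟩ := ENNReal.lt_iff_exists_nnreal_btwn.1 he
  have he'' : 0 < e' := by exact_mod_cast he'
  -- The bound below adds up `δ` for the distortion, `2 * δ` for the diameters of the pieces,
  -- `2 * δ` for the transport error and `δ` for the difference of the masses.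
  set δ : ℝ≥0 := e' / 6 with hδdef
  have hδ : 0 < δ := by positivity
  obtain ⟨Q, hQo, hQd, hQδ, hQν⟩ := exists_open_partition (ν : Measure Y) (δ := δ) hδ
  have hsum : HasSum (fun i => ν (Q i)) ν.mass := by
    rw [← ENNReal.hasSum_coe, FiniteMeasure.ennreal_mass]
    simp only [FiniteMeasure.ennreal_coeFn_eq_coeFn_toMeasure]
    have hU : MeasurableSet (⋃ i, Q i) := (isOpen_iUnion hQo).measurableSet
    rw [← measure_add_measure_compl hU, hQν, add_zero,
      measure_iUnion hQd fun i => (hQo i).measurableSet]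
    exact ENNReal.summable.hasSum
  obtain ⟨k, hk⟩ := ((hsum.tendsto_sum_nat.add_const δ).eventually_const_lt
    (lt_add_of_pos_right ν.mass hδ)).exists
  have hmass : Tendsto (fun n => (μ n).mass) atTop (𝓝 ν.mass) := by
    refine hlim.mass.congr fun n => ?_
    rw [FiniteMeasure.mass, FiniteMeasure.map_apply _ (hp n) MeasurableSet.univ]
    rfl
  have hDlim : Tendsto (fun n => ((k : ℝ≥0) + 1) * (((μ n).mass - min (μ n).mass ν.mass) +
      (ν.mass - min (μ n).mass ν.mass))) atTop (𝓝 0) := by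
    have hmin := hmass.min (tendsto_const_nhds (x := ν.mass))
    simpa using ((hmass.sub hmin).add ((tendsto_const_nhds (x := ν.mass)).sub hmin)).const_mul
      ((k : ℝ≥0) + 1)
  have hpiece : ∀ᶠ n in atTop, ∀ i ∈ Finset.range k,
      ν (Q i) ≤ (μ n).map (p n) (Q i) + δ / (k + 1) :=
    (Finset.eventually_all _).2 fun i _ =>
      eventually_apply_le_add_of_tendsto hlim (hQo i) (by positivity)
  filter_upwards [hpiece, hDlim.eventually_le_const hδ,
    hε.eventually_le_const (show (0 : ℝ) < δ from hδ)] with n hn1 hn2 hn3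
  have hη : ν.mass ≤
      ∑ i ∈ Finset.range k, min (μ n (p n ⁻¹' Q i)) (ν (Q i)) + 2 * δ := by
    refine hk.le.trans ?_
    have hterm : ∀ i ∈ Finset.range k,
        ν (Q i) ≤ min (μ n (p n ⁻¹' Q i)) (ν (Q i)) + δ / (k + 1) := fun i hi => by
      rw [← min_add_add_right]
      refine le_min ?_ le_self_add
      rw [← FiniteMeasure.map_apply _ (hp n) (hQo i).measurableSet]
      exact hn1 i hi
    calc _ ≤ ∑ i ∈ Finset.range k, (min (μ n (p n ⁻¹' Q i)) (ν (Q i)) + δ / (k + 1)) + δ := by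
          gcongr with i hi
          exact hterm i hi
      _ = ∑ i ∈ Finset.range k, min (μ n (p n ⁻¹' Q i)) (ν (Q i)) + (k * (δ / (k + 1)) + δ) := by
          rw [Finset.sum_add_distrib, Finset.sum_const, Finset.card_range, nsmul_eq_mul, add_assoc]
      _ ≤ _ := by
          rw [two_mul]
          gcongr
          rw [mul_div_left_comm]
          exact mul_le_of_le_one_right' (div_le_one_of_le₀ le_self_add zero_le)
  refine (boxDist_le_of_map rfl rfl (hp n) (hA n) (ε := δ) hδ ?_
    (fun x hx y hy => (hpA n x hx y hy).trans hn3) (fun i => (hQo i).measurableSet) hQd hQδ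
    hη).trans (le_trans (ENNReal.coe_le_coe.2 ?_) hee.le)
  · rw [← ENNReal.coe_le_coe, FiniteMeasure.ennreal_coeFn_eq_coeFn_toMeasure,
      ← ENNReal.ofReal_coe_nnreal]
    exact (hAε n).trans (ENNReal.ofReal_le_ofReal hn3)
  · generalize (μ n).mass - min (μ n).mass ν.mass + (ν.mass - min (μ n).mass ν.mass) = D at *
    calc δ + 2 * δ + 2 * δ + k * D + D = 5 * δ + (k + 1) * D := by ring
      _ ≤ 5 * δ + δ := by gcongr
      _ = e' := by
        rw [hδdef]
        field_simp
        norm_num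

end OfMap

end MMSpaces

theorem mainTheorem3 {X : ℕ → Type*} {Y : Type*}
    [∀ n, MetricSpace (X n)] [∀ n, CompleteSpace (X n)]
    [∀ n, TopologicalSpace.SeparableSpace (X n)] [∀ n, Nonempty (X n)]
    [∀ n, MeasurableSpace (X n)] [∀ n, BorelSpace (X n)]
    [MetricSpace Y] [CompleteSpace Y] [TopologicalSpace.SeparableSpace Y] [Nonempty Y]
    [MeasurableSpace Y] [BorelSpace Y]
    (μ : ∀ n, FiniteMeasure (X n)) (ν : FiniteMeasure Y) :
    Tendsto (fun n => MMSpaces.boxDist 1 (μ n) ν) atTop (𝓝 0) ↔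
      ∃ (p : ∀ n, X n → Y) (A : ∀ n, Set (X n)) (ε : ℕ → ℝ),
        (∀ n, Measurable (p n)) ∧ (∀ n, MeasurableSet (A n)) ∧ (∀ n, 0 < ε n) ∧
        Tendsto ε atTop (𝓝 0) ∧
        (∀ n, (μ n : Measure (X n)) (A n)ᶜ ≤ ENNReal.ofReal (ε n)) ∧
        (∀ n, ∀ x ∈ A n, ∀ y ∈ A n, |dist x y - dist (p n x) (p n y)| ≤ ε n) ∧
        Tendsto (fun n => (μ n).map (p n)) atTop (𝓝 ν) := by
  constructor
  · intro h
    -- The summand `1 / (n + 1)` makes `e n` strictly larger than the box distance.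
    set e : ℕ → ℝ := fun n => (MMSpaces.boxDist 1 (μ n) ν).toReal + 1 / ((n : ℝ) + 1) with he
    have hpos : ∀ n, 0 < e n := fun n => by positivity
    have he0 : Tendsto e atTop (𝓝 0) := by
      simpa [he] using ((ENNReal.tendsto_toReal ENNReal.zero_ne_top).comp h).add
        tendsto_one_div_add_atTop_nhds_zero_nat
    have hlt : ∀ n, MMSpaces.boxDist 1 (μ n) ν < ENNReal.ofReal (e n) := fun n => by
      refine (ENNReal.lt_ofReal_iff_toReal_lt (MMSpaces.boxDist_lt_top (μ n) ν).ne).2 ?_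
      exact lt_add_of_pos_right _ (by positivity)
    choose p A hp hA hAe hpA hint using fun n =>
      MMSpaces.exists_map_of_boxDist_lt (μ n) ν (hlt n)
    refine ⟨p, A, fun n => 3 * e n, hp, hA, fun n => by linarith [hpos n],
      by simpa using he0.const_mul 3, fun n => (hAe n).trans
        (ENNReal.ofReal_le_ofReal (by linarith [hpos n])), hpA, ?_⟩
    refine MMSpaces.tendsto_of_forall_lipschitz_integral_tendsto fun f C L hC hL => ?_
    refine tendsto_iff_dist_tendsto_zero.2 (squeeze_zero (fun _ => dist_nonneg)
      (fun n => hint n f C L hC hL) ?_)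
    simpa using he0.const_mul (3 * C + 2 * L * ν.mass)
  · rintro ⟨p, A, ε, hp, hA, -, hε, hAε, hpA, hlim⟩
    exact MMSpaces.tendsto_boxDist_of_map hp hA hε hAε hpA hlim
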